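/- Let $X=(X_t)_{t\ge1}$ be an arbitrary real Gaussian sequence with mean $m_t=\mathbb E X_t$ and covariance $K(t,s)=\mathbb E (X_t-m_t)(X_s-m_s)$, let $A=(A_t)_{t\ge1}$ be a sequence of real numbers, and let $Y_t=A_tX_t+\varepsilon_t$, $t\ge1$, where $(\varepsilon_t)_{t\ge1}$ are i.i.d. $\mathcal N(0,1)$ random variables independent of $X$. Let $\mathcal Y_t=\sigma(Y_u,\,1\le u\le t)$. Fix a horizon $T\ge1$, a real number $\mu$ and nonnegative real numbers $(Q_t)_{t\ge1}$, and put $S_l=A_l^2-\mu Q_l$. Assume condition $(C_\mu)$: the equation $$\overline\gamma(t,s)=K(t,s)-\sum_{l=1}^{s-1}\overline\gamma(t,l)\,\overline\gamma(s,l)\,\frac{S_l}{1+S_l\overline\gamma_l},\qquad \overline\gamma_l=\overline\gamma(l,l),$$ has a unique and bounded solution on $\{(t,s):1\le s\le t\le T\}$, and this solution satisfies $\overline\gamma_l\ge0$ and $1+S_l\overline\gamma_l>0$ for $1\le l\le T$. Then the equation $$\overline h_t=m_t+\sum_{l=1}^{t}A_l\,\overline\gamma(t,l)\,(Y_l-A_l\overline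 h_l),\qquad 1\le t\le T,$$ has a unique solution $\overline h=(\overline h_t)_{1\le t\le T}$; each $\overline h_t$ is $\mathcal Y_t$-measurable, and $\overline h$ minimizes $$\mathbb E\,\mu\exp\Big\{\frac{\mu}{2}\sum_{t=1}^{T}(X_t-h_t)^2Q_t\Big\}\in[-\infty,\infty]$$ over all $h=(h_t)_{1\le t\le T}$ such that $h_t$ is $\mathcal Y_t$-measurable for every $t$. Moreover, the optimal risk is $$\mathbb E\,\mu\exp\Big\{\frac{\mu}{2}\sum_{t=1}^{T}(X_t-\overline h_t)^2Q_t\Big\}=\mu\prod_{t=1}^{T}\left[\frac{1+S_t\overline\gamma_t}{1+A_t^2\overline\gamma_t}\right]^{-1/2}.$$ -/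

import Mathlib

open MeasureTheory ProbabilityTheory
open scoped ENNReal

noncomputable section

namespace LEG

/-- The observation process `Y_t = A_t X_t + ε_t`, `t ≥ 1` (time is indexed by `ℕ+`). -/
def obs {Ω : Type*} (A : ℕ+ → ℝ) (X ε : ℕ+ → Ω → ℝ) (t : ℕ+) (ω : Ω) : ℝ :=
  A t * X t ω + ε t ω

/-- The σ-field `𝒴_t = σ(Y_u, 1 ≤ u ≤ t)`. -/
abbrev obsSigma {Ω : Type*} (Y : ℕ+ → Ω → ℝ) (t : ℕ+) : MeasurableSpace Ω :=
  ⨆ u ∈ Finset.Iic t, MeasurableSpace.comap (Y u) inferInstance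

/-- Estimators up to the horizon `T`: families `h` with `h_t` being `𝒴_t`-measurable for
all `1 ≤ t ≤ T`. (The criterion involves `h_1, …, h_T` only.) -/
def adaptedEstimators {Ω : Type*} (T : ℕ+) (Y : ℕ+ → Ω → ℝ) : Set (ℕ+ → Ω → ℝ) :=
  {h | ∀ t ≤ T, Measurable[obsSigma Y t] (h t)}

/-- The criterion `E μ exp {(μ/2) ∑_{t ≤ T} (X_t - h_t)² Q_t}`. The integrand has the constant
sign of `μ`, so that its expectation always exists in `[-∞, ∞]`; it is `μ` times the expectation
in `[0, ∞]` of the exponential (with `0 * ∞ = 0`, the integrand being zero if `μ = 0`). -/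
def risk {Ω : Type*} [MeasurableSpace Ω] (P : Measure Ω) (T : ℕ+) (μ : ℝ) (Q : ℕ+ → ℝ)
    (X h : ℕ+ → Ω → ℝ) : EReal :=
  (μ : EReal) * ((∫⁻ ω, ENNReal.ofReal
    (Real.exp (μ / 2 * ∑ t ∈ Finset.Iic T, (X t ω - h t ω) ^ 2 * Q t)) ∂P : ℝ≥0∞) : EReal)

/-- `S_l = A_l² - μ Q_l`. -/
def S (μ : ℝ) (A Q : ℕ+ → ℝ) (l : ℕ+) : ℝ := A l ^ 2 - μ * Q l

/-- `γ` solves, on `{(t, s) : 1 ≤ s ≤ t ≤ T}`, the Riccati–Volterra equation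
`γ(t,s) = K(t,s) - ∑_{l=1}^{s-1} γ(t,l) γ(s,l) S_l / (1 + S_l γ(l,l))`; the denominators that
occur in the equation are required not to vanish. -/
def IsRiccatiVolterraSolution (T : ℕ+) (μ : ℝ) (K : ℕ+ → ℕ+ → ℝ) (A Q : ℕ+ → ℝ)
    (γ : ℕ+ → ℕ+ → ℝ) : Prop :=
  ∀ t s : ℕ+, s ≤ t → t ≤ T →
    (∀ l < s, 1 + S μ A Q l * γ l l ≠ 0) ∧
    γ t s = K t s - ∑ l ∈ Finset.Iio s,
      γ t l * γ s l * (S μ A Q l / (1 + S μ A Q l * γ l l))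

/-- The condition `(C_μ)`: the Riccati–Volterra equation has a unique and bounded solution on
`{(t, s) : 1 ≤ s ≤ t ≤ T}`, and it satisfies `γ(l,l) ≥ 0` and `1 + S_l γ(l,l) > 0`. -/
def CondC (T : ℕ+) (μ : ℝ) (K : ℕ+ → ℕ+ → ℝ) (A Q : ℕ+ → ℝ) : Prop :=
  ∃ γ : ℕ+ → ℕ+ → ℝ, IsRiccatiVolterraSolution T μ K A Q γ ∧
    (∀ γ' : ℕ+ → ℕ+ → ℝ, IsRiccatiVolterraSolution T μ K A Q γ' →
      ∀ t s : ℕ+, s ≤ t → t ≤ T → γ' t s = γ t s) ∧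
    (∃ C : ℝ, ∀ t s : ℕ+, s ≤ t → t ≤ T → |γ t s| ≤ C) ∧
    (∀ l ≤ T, 0 ≤ γ l l) ∧
    (∀ l ≤ T, 0 < 1 + S μ A Q l * γ l l)

/-- `h` solves `h_t = m_t + ∑_{l=1}^{t} A_l γ(t,l) (Y_l - A_l h_l)` for `1 ≤ t ≤ T`. -/
def SolvesFilter {Ω : Type*} (T : ℕ+) (m : ℕ+ → ℝ) (A : ℕ+ → ℝ) (γ : ℕ+ → ℕ+ → ℝ)
    (Y h : ℕ+ → Ω → ℝ) : Prop :=
  ∀ t ≤ T, ∀ ω, h t ω = m t + ∑ l ∈ Finset.Iic t, A l * γ t l * (Y l ω - A l * h l ω)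

end LEG

end

/-! The proof is dynamic programming on the horizon, peeling off the first time. Given the first
observation `y` and estimate `a = h_0(y)`, the product of the observation density and the first cost
factor is the exponential of a quadratic in `x_0`. Completing the square
(`exp_mul_gaussianPDFReal_observation`) splits it into a constant, the Gaussian density of `y`, a
factor `exp (μ · coefficient · (a - filter value)²)` with nonnegative coefficient, and a normalised
exponential-quadratic tilt in `x_0`.

Under the tilt the future signal is again Gaussian (`exists_isGaussian_tilt`). Its covariance
undergoes one step of the Riccati–Volterra recursion and depends on neither `y` nor `a`; only its
mean does. What remains is the same problem with one time fewer, and since the claimed optimal value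
does not involve the mean, induction applies for every `y`, whatever `a` was (`expCost_bound`).

The extra factor is at least 1 if `μ ≥ 0` and at most 1 if `μ ≤ 0`, giving in both cases the
inequality needed after multiplication by `μ`. It equals 1 when `a` is the filter value; then the
tilted mean is `m_t + A_0 γ(t,0) (y - A_0 a)`, so the later filter equations are those of the
reduced problem and equality propagates. -/

/-! ### Exponential-quadratic tilting of Gaussian laws -/

theorem exp_mul_gaussianPDFReal {S v : ℝ} (b : ℝ) (hv : 0 < v) (hS : 0 < 1 + S * v) (z : ℝ) :
    Real.exp (-S / 2 * z ^ 2 + b * z) * gaussianPDFReal 0 v.toNNReal z =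
      (√(1 + S * v))⁻¹ * Real.exp (b ^ 2 * v / (2 * (1 + S * v))) *
        gaussianPDFReal (v * b / (1 + S * v)) (v / (1 + S * v)).toNNReal z := by
  have hD := hS.ne'
  have hv' := hv.ne'
  have hq : 0 ≤ v / (1 + S * v) := by positivity
  have h1 : √(2 * Real.pi * v) = √(1 + S * v) * √(2 * Real.pi * (v / (1 + S * v))) := by
    rw [← Real.sqrt_mul hS.le]
    congr 1
    rw [show (1 + S * v) * (2 * Real.pi * (v / (1 + S * v))) =
      2 * Real.pi * v * ((1 + S * v) / (1 + S * v)) by ring, div_self hD, mul_one]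
  simp only [gaussianPDFReal, Real.coe_toNNReal v hv.le, Real.coe_toNNReal _ hq, h1, mul_inv]
  have h2 : -S / 2 * z ^ 2 + b * z + -(z - 0) ^ 2 / (2 * v) =
      b ^ 2 * v / (2 * (1 + S * v)) +
        -(z - v * b / (1 + S * v)) ^ 2 / (2 * (v / (1 + S * v))) := by
    field_simp
    ring
  have h3 := congrArg Real.exp h2
  rw [Real.exp_add, Real.exp_add _ (-(z - v * b / (1 + S * v)) ^ 2 / (2 * (v / (1 + S * v))))]
    at h3
  calc _ = (√(1 + S * v))⁻¹ * (√(2 * Real.pi * (v / (1 + S * v))))⁻¹ *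
        (Real.exp (-S / 2 * z ^ 2 + b * z) * Real.exp (-(z - 0) ^ 2 / (2 * v))) := by ring
    _ = _ := by rw [h3]; ring

theorem lintegral_exp_quadratic_gaussianReal {S v : ℝ} (b : ℝ) (hv : 0 ≤ v) (hS : 0 < 1 + S * v)
    {g : ℝ → ℝ≥0∞} (hg : Measurable g) :
    ∫⁻ z, ENNReal.ofReal (Real.exp (-S / 2 * z ^ 2 + b * z)) * g z
        ∂gaussianReal 0 v.toNNReal =
      ENNReal.ofReal ((√(1 + S * v))⁻¹ * Real.exp (b ^ 2 * v / (2 * (1 + S * v)))) *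
        ∫⁻ z, g z ∂gaussianReal (v * b / (1 + S * v)) (v / (1 + S * v)).toNNReal := by
  -- For `v = 0` both Gaussians are the Dirac mass at 0, where the weight is 1.
  rcases hv.eq_or_lt with rfl | hv
  · simp
  have h1 : v.toNNReal ≠ 0 := by simpa using hv
  have h2 : (v / (1 + S * v)).toNNReal ≠ 0 := by simpa using div_pos hv hS
  rw [gaussianReal_of_var_ne_zero _ h1, gaussianReal_of_var_ne_zero _ h2,
    lintegral_withDensity_eq_lintegral_mul _ (measurable_gaussianPDF _ _) (by fun_prop),
    lintegral_withDensity_eq_lintegral_mul _ (measurable_gaussianPDF _ _) hg,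
    ← lintegral_const_mul _ (by fun_prop)]
  refine lintegral_congr fun z => ?_
  simp only [Pi.mul_apply, gaussianPDF]
  rw [← mul_assoc, ← mul_assoc, ← ENNReal.ofReal_mul (gaussianPDFReal_nonneg _ _ _),
    ← ENNReal.ofReal_mul (mul_nonneg (inv_nonneg.2 (Real.sqrt_nonneg _)) (Real.exp_pos _).le), mul_comm (gaussianPDFReal _ _ _),
    exp_mul_gaussianPDFReal b hv hS]

/-- Weighting a Gaussian vector by the exponential of a quadratic function of its first coordinate
leaves the other coordinates Gaussian. -/
theorem exists_isGaussian_tilt {n : ℕ} {ν : Measure (Fin (n + 1) → ℝ)} [IsGaussian ν]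
    {m : Fin (n + 1) → ℝ} {K : Fin (n + 1) → Fin (n + 1) → ℝ}
    (hm : ∀ t, ∫ x, x t ∂ν = m t) (hK : ∀ t s, cov[fun x => x t, fun x => x s; ν] = K t s)
    {S : ℝ} (b : ℝ) (hS : 0 < 1 + S * K 0 0) :
    ∃ ν' : Measure (Fin n → ℝ), IsGaussian ν' ∧
      (∀ t, ∫ x, x t ∂ν' = m t.succ + K t.succ 0 * (b / (1 + S * K 0 0))) ∧
      (∀ t s, cov[fun x => x t, fun x => x s; ν'] =
        K t.succ s.succ - K t.succ 0 * K s.succ 0 * (S / (1 + S * K 0 0))) ∧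
      ∀ G : (Fin n → ℝ) → ℝ≥0∞, Measurable G →
        ∫⁻ x, ENNReal.ofReal (Real.exp (-S / 2 * (x 0 - m 0) ^ 2 + b * (x 0 - m 0))) *
            G (fun t => x t.succ) ∂ν =
          ENNReal.ofReal ((√(1 + S * K 0 0))⁻¹ *
            Real.exp (b ^ 2 * K 0 0 / (2 * (1 + S * K 0 0)))) * ∫⁻ x, G x ∂ν' := by
  set v := K 0 0 with hv_def
  have hX : HasGaussianLaw (fun x : Fin (n + 1) → ℝ => x) ν := IsGaussian.hasGaussianLaw_id
  have hL2 : ∀ t, MemLp (fun x : Fin (n + 1) → ℝ => x t) 2 ν := fun t =>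
    (hX.eval (X := fun t (x : Fin (n + 1) → ℝ) => x t) t).memLp_two
  have hint : ∀ t, Integrable (fun x : Fin (n + 1) → ℝ => x t) ν := fun t =>
    (hL2 t).integrable (by norm_num)
  have hsym : ∀ t s, K t s = K s t := fun t s => by rw [← hK, ← hK, covariance_comm]
  have hvar : Var[fun x : Fin (n + 1) → ℝ => x 0; ν] = v := by
    rw [← covariance_self (measurable_pi_apply 0).aemeasurable, hK]
  have hv : 0 ≤ v := hvar ▸ variance_nonneg _ _
  -- A degenerate first coordinate is almost surely constant, so the regression coefficients `K
  -- t.succ 0 / v`, which are 0 by convention when `v = 0`, remain correct.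
  have hv0 : v = 0 → ∀ t, K t 0 = 0 := by
    intro h0 t
    have h1 := ae_eq_integral_of_variance_eq_zero (hL2 0) (hvar.trans h0)
    rw [← hK, covariance]
    rw [← integral_zero (Fin (n + 1) → ℝ) ℝ (μ := ν)]
    apply integral_congr_ae
    filter_upwards [h1] with x hx
    simp [hx]
  set k : Fin n → ℝ := fun t => K t.succ 0 / v with hk
  have hkv : ∀ t, k t * v = K t.succ 0 := by
    intro t
    rcases eq_or_ne v 0 with h | h
    · simp [h, hv0 h]
    · simp [hk, h]
  -- the first coordinate and the regression residual
  set Z : (Fin (n + 1) → ℝ) → ℝ := fun x => x 0 - m 0 with hZ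
  set R : (Fin (n + 1) → ℝ) → (Fin n → ℝ) := fun x t => x t.succ - k t * x 0 with hR
  have hZm : Measurable Z := by fun_prop
  have hRm : Measurable R := by fun_prop
  have hZlaw : ν.map Z = gaussianReal 0 v.toNNReal := by
    have h1 := (hX.eval (X := fun t (x : Fin (n + 1) → ℝ) => x t) 0).map_eq_gaussianReal
    rw [hvar, hm] at h1
    have h2 := gaussianReal_map_sub_const (μ := m 0) (v := v.toNNReal) (m 0)
    rw [← h1, Measure.map_map (by fun_prop) (by fun_prop), sub_self] at h2
    exact h2
  -- Jointly Gaussian and uncorrelated implies independent; the constant family over `Fin 1`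
  -- presents `x 0` as a vector.
  have hind0 : IndepFun R (fun x (_ : Fin 1) => x 0) ν := by
    let L : (Fin (n + 1) → ℝ) →L[ℝ] (Fin n → ℝ) × (Fin 1 → ℝ) :=
      (ContinuousLinearMap.pi fun t => ContinuousLinearMap.proj (R := ℝ) (φ := fun _ => ℝ) t.succ -
        k t • ContinuousLinearMap.proj (R := ℝ) (φ := fun _ => ℝ) 0).prod
      (ContinuousLinearMap.pi fun _ => ContinuousLinearMap.proj (R := ℝ) (φ := fun _ => ℝ) 0)
    have hG : HasGaussianLaw (fun x : Fin (n + 1) → ℝ =>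
        ((fun t => x t.succ - k t * x 0 : Fin n → ℝ), (fun _ => x 0 : Fin 1 → ℝ))) ν :=
      hX.map_fun L
    refine HasGaussianLaw.indepFun_of_covariance_eval
      (X := fun (t : Fin n) (x : Fin (n + 1) → ℝ) => x t.succ - k t * x 0)
      (Y := fun (_ : Fin 1) (x : Fin (n + 1) → ℝ) => x 0) hG fun t _ => ?_
    rw [covariance_fun_sub_left (hL2 _) ((hL2 _).const_mul _) (hL2 _),
      covariance_const_mul_left, hK, hK, ← hv_def, hkv, sub_self]
  have hind : IndepFun R Z ν :=
    hind0.comp (φ := id) (ψ := fun y : Fin 1 → ℝ => y 0 - m 0) measurable_id (by fun_prop)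
  have hprod := (indepFun_iff_map_prod_eq_prod_map_map hRm.aemeasurable hZm.aemeasurable).1 hind
  set D := 1 + S * v with hD
  -- The tilt turns `N(0, v)` into `N(v b / D, v / D)`, the image of `N(0, v)` under `z ↦ ρ z + v b
  -- / D`.
  set ρ := (√D)⁻¹ with hρ
  have hρ2 : ρ ^ 2 = D⁻¹ := by rw [hρ, inv_pow, Real.sq_sqrt hS.le]
  -- the transformed vector
  set U : (Fin (n + 1) → ℝ) → (Fin n → ℝ) :=
    fun x t => x t.succ + k t * ((ρ - 1) * (x 0 - m 0) + v * b / D) with hU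
  have hUm : Measurable U := by fun_prop
  have hUG : HasGaussianLaw U ν := by
    let L : (Fin (n + 1) → ℝ) →L[ℝ] (Fin n → ℝ) :=
      ContinuousLinearMap.pi fun t => ContinuousLinearMap.proj (R := ℝ) (φ := fun _ => ℝ) t.succ +
        (k t * (ρ - 1)) • ContinuousLinearMap.proj (R := ℝ) (φ := fun _ => ℝ) 0
    have h1 : IsGaussian ((ν.map L).map
        (fun x => x + fun t => k t * (v * b / D - (ρ - 1) * m 0))) := inferInstance
    rw [Measure.map_map (by fun_prop) (by fun_prop)] at h1
    have : U = (fun x => x + fun t => k t * (v * b / D - (ρ - 1) * m 0)) ∘ L := by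
      funext x t
      simp [hU, L]
      ring
    rw [← this] at h1
    exact ⟨h1⟩
  refine ⟨ν.map U, hUG.isGaussian_map, fun t => ?_, fun t s => ?_, fun G hGm => ?_⟩
  · rw [integral_map hUm.aemeasurable (measurable_pi_apply t).aestronglyMeasurable]
    have : ∀ x : Fin (n + 1) → ℝ, U x t =
        x t.succ + (k t * (ρ - 1)) * (x 0 - m 0) + k t * (v * b / D) := fun x => by
      simp only [hU]; ring
    simp_rw [this]
    have hi0 : Integrable (fun x : Fin (n + 1) → ℝ => k t * (ρ - 1) * (x 0 - m 0)) ν :=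
      ((hint 0).sub (integrable_const (m 0))).const_mul (k t * (ρ - 1))
    have hi1 : Integrable
        (fun x : Fin (n + 1) → ℝ => x t.succ + k t * (ρ - 1) * (x 0 - m 0)) ν :=
      (hint t.succ).add hi0
    rw [integral_add hi1 (integrable_const _), integral_add (hint _) hi0,
      integral_const_mul, integral_sub (hint 0) (integrable_const _), hm, hm,
      integral_const, integral_const]
    simp only [probReal_univ, one_smul]
    rw [← hkv]
    ring
  · rw [covariance_map_fun (measurable_pi_apply t).aestronglyMeasurable
      (measurable_pi_apply s).aestronglyMeasurable hUm.aemeasurable]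
    have hU' : ∀ t, (fun x : Fin (n + 1) → ℝ => U x t) = fun x =>
        (x t.succ + (k t * (ρ - 1)) * x 0) + k t * (v * b / D - (ρ - 1) * m 0) := fun t => by
      funext x
      simp only [hU]; ring
    have hL2' : ∀ c : ℝ, MemLp (fun x : Fin (n + 1) → ℝ => c * x 0) 2 ν := fun c =>
      (hL2 0).const_mul c
    have hL2'' : ∀ t c, MemLp (fun x : Fin (n + 1) → ℝ => x t + c * x 0) 2 ν := fun t c =>
      (hL2 t).add (hL2' c)
    have hadd : ∀ t s c d, cov[fun x : Fin (n + 1) → ℝ => x t + c * x 0,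
        fun x => x s + d * x 0; ν] = K t s + d * K t 0 + c * K s 0 + c * d * v := by
      intro t s c d
      have e1 := covariance_add_left (hL2 t) (hL2' c) (hL2'' s d)
      have e2 := covariance_add_right (hL2 t) (hL2 s) (hL2' d)
      have e3 := covariance_add_right (hL2' c) (hL2 s) (hL2' d)
      simp only [Pi.add_def] at e1 e2 e3
      rw [e1, e2, e3]
      simp only [covariance_const_mul_left, covariance_const_mul_right, hK]
      rw [hsym 0 s]
      ring
    rw [hU', hU', covariance_add_const_left ((hL2'' _ _).integrable (by norm_num)),
      covariance_add_const_right ((hL2'' _ _).integrable (by norm_num)), hadd, ← hkv, ← hkv]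
    have hDne : D ≠ 0 := hS.ne'
    have h2 : S * v = D - 1 := by rw [hD]; ring
    have h3 : S / D * v = 1 - ρ ^ 2 := by rw [hρ2]; field_simp; linarith
    -- The covariance changes by `k t * k s * v * (ρ ^ 2 - 1)`.
    linear_combination (k t * k s * v) * h3
  · have h1 : ∀ x : Fin (n + 1) → ℝ,
        (fun t : Fin n => x t.succ) = fun t => R x t + k t * (Z x + m 0) := fun x => by
      funext t; simp only [hR, hZ]; ring
    have h2 : ∀ x : Fin (n + 1) → ℝ,
        U x = fun t => R x t + k t * ((ρ * Z x + v * b / D) + m 0) := fun x => by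
      funext t; simp only [hR, hZ, hU]; ring
    have hnv : NNReal.mk (ρ ^ 2) (sq_nonneg _) * v.toNNReal = (v / D).toNNReal := by
      ext
      rw [Real.coe_toNNReal _ (div_nonneg hv hS.le)]
      simp only [NNReal.coe_mul, NNReal.coe_mk, Real.coe_toNNReal _ hv, hρ2]
      field_simp
    have hZ' : (gaussianReal 0 v.toNNReal).map (fun z => ρ * z + v * b / D) =
        gaussianReal (v * b / D) (v / D).toNNReal := by
      have e1 := gaussianReal_map_const_mul (μ := 0) (v := v.toNNReal) ρ
      have e2 := gaussianReal_map_add_const (μ := 0) (v := (v / D).toNNReal) (v * b / D)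
      rw [mul_zero] at e1
      rw [zero_add] at e2
      rw [← e2, ← hnv]
      erw [← e1]
      rw [Measure.map_map (by fun_prop) (by fun_prop)]
      rfl
    rw [lintegral_map hGm hUm]
    simp_rw [h2]
    have e1 : ∫⁻ x, ENNReal.ofReal (Real.exp (-S / 2 * (x 0 - m 0) ^ 2 + b * (x 0 - m 0))) *
        G (fun t => x t.succ) ∂ν = ∫⁻ p, ENNReal.ofReal (Real.exp (-S / 2 * p.2 ^ 2 + b * p.2)) *
        G (fun t => p.1 t + k t * (p.2 + m 0)) ∂(ν.map fun x => (R x, Z x)) := by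
      rw [lintegral_map (by fun_prop) (by fun_prop)]
      refine lintegral_congr fun x => ?_
      rw [h1 x]
    have e2 : ∫⁻ x, G (fun t => R x t + k t * ((ρ * Z x + v * b / D) + m 0)) ∂ν =
        ∫⁻ p, G (fun t => p.1 t + k t * ((ρ * p.2 + v * b / D) + m 0))
          ∂(ν.map fun x => (R x, Z x)) := by
      rw [lintegral_map (by fun_prop) (by fun_prop)]
    rw [e1, e2, hprod, hZlaw]
    have : IsProbabilityMeasure (ν.map R) := Measure.isProbabilityMeasure_map hRm.aemeasurable
    rw [lintegral_prod _ (by fun_prop), lintegral_prod _ (by fun_prop),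
      ← lintegral_const_mul _ (by fun_prop)]
    refine lintegral_congr fun r => ?_
    rw [lintegral_exp_quadratic_gaussianReal b hv hS
      (g := fun z => G (fun t => r t + k t * (z + m 0))) (by fun_prop), ← hZ',
      lintegral_map (by fun_prop) (by fun_prop)]

/-! ### Integrating out one signal coordinate against one observation -/

/-- The exponents agree as quadratics in `x`, `y`, `a`. The square on the right measures how far `a`
is from the posterior mean of the signal given `y`; the last factor on the left is the total mass of
the tilt on the right. -/
theorem exp_mul_gaussianPDFReal_observation {A Q μ v m₀ : ℝ} (hv : 0 ≤ v)
    (hS : 0 < 1 + (A ^ 2 - μ * Q) * v) (x y a : ℝ) :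
    gaussianPDFReal (A * x) 1 y * Real.exp (μ / 2 * ((x - a) ^ 2 * Q)) *
      ((√(1 + (A ^ 2 - μ * Q) * v))⁻¹ *
        Real.exp ((A * (y - A * m₀) - μ * Q * (a - m₀)) ^ 2 * v /
          (2 * (1 + (A ^ 2 - μ * Q) * v)))) =
    √((1 + A ^ 2 * v) / (1 + (A ^ 2 - μ * Q) * v)) *
      (gaussianPDFReal (A * m₀) (1 + A ^ 2 * v).toNNReal y *
        Real.exp (μ * (Q * ((1 + A ^ 2 * v) / (2 * (1 + (A ^ 2 - μ * Q) * v))) *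
          (a - m₀ - v * A / (1 + A ^ 2 * v) * (y - A * m₀)) ^ 2))) *
      Real.exp (-(A ^ 2 - μ * Q) / 2 * (x - m₀) ^ 2 +
        (A * (y - A * m₀) - μ * Q * (a - m₀)) * (x - m₀)) := by
  have hB : 0 < 1 + A ^ 2 * v := by positivity
  have hexp : -(y - A * x) ^ 2 / (2 * 1) + μ / 2 * ((x - a) ^ 2 * Q) +
      (A * (y - A * m₀) - μ * Q * (a - m₀)) ^ 2 * v / (2 * (1 + (A ^ 2 - μ * Q) * v)) =
      -(y - A * m₀) ^ 2 / (2 * (1 + A ^ 2 * v)) +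
      μ * (Q * ((1 + A ^ 2 * v) / (2 * (1 + (A ^ 2 - μ * Q) * v))) *
          (a - m₀ - v * A / (1 + A ^ 2 * v) * (y - A * m₀)) ^ 2) +
      (-(A ^ 2 - μ * Q) / 2 * (x - m₀) ^ 2 +
        (A * (y - A * m₀) - μ * Q * (a - m₀)) * (x - m₀)) := by
    have h1 := hB.ne'
    have h2 := hS.ne'
    -- The two denominators are kept as atoms while fractions are cleared.
    obtain ⟨D, hD⟩ : ∃ D, D = 1 + (A ^ 2 - μ * Q) * v := ⟨_, rfl⟩
    obtain ⟨B, hB⟩ : ∃ B, B = 1 + A ^ 2 * v := ⟨_, rfl⟩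
    rw [← hD] at h2 ⊢
    rw [← hB] at h1 ⊢
    field_simp
    subst hD hB
    ring
  have hsq : √(2 * Real.pi * (1 + A ^ 2 * v)) = √(2 * Real.pi) * √(1 + A ^ 2 * v) :=
    Real.sqrt_mul (by positivity) _
  have h3 := congrArg Real.exp hexp
  simp only [Real.exp_add _ (μ / 2 * _), Real.exp_add _ (_ / (2 * (1 + (A ^ 2 - μ * Q) * v))),
    Real.exp_add _ (μ * _), Real.exp_add _ (_ + _ * (x - m₀))] at h3
  have h4 : √(1 + A ^ 2 * v) ≠ 0 := (Real.sqrt_pos.2 hB).ne'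
  simp only [gaussianPDFReal, Real.coe_toNNReal _ hB.le, NNReal.coe_one, hsq, mul_inv,
    Real.sqrt_div hB.le, mul_one] at h3 ⊢
  have h5 : √(1 + A ^ 2 * v) * (√(1 + A ^ 2 * v))⁻¹ = 1 := mul_inv_cancel₀ h4
  generalize Real.exp (-(y - A * m₀) ^ 2 / (2 * (1 + A ^ 2 * v))) = E₁ at h3 ⊢
  generalize Real.exp (μ * _) = E₂ at h3 ⊢
  generalize Real.exp (-(A ^ 2 - μ * Q) / 2 * (x - m₀) ^ 2 + _) = E₃ at h3 ⊢
  linear_combination (√(2 * Real.pi))⁻¹ * (√(1 + (A ^ 2 - μ * Q) * v))⁻¹ * h3 -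
    (√(2 * Real.pi))⁻¹ * (√(1 + (A ^ 2 - μ * Q) * v))⁻¹ * E₁ * E₂ * E₃ * h5

/-- Integrating out the first coordinate of the signal, for a given first observation. -/
theorem exists_isGaussian_lintegral_observation {n : ℕ} {ν : Measure (Fin (n + 1) → ℝ)}
    [IsGaussian ν] {m : Fin (n + 1) → ℝ} {K : Fin (n + 1) → Fin (n + 1) → ℝ}
    (hm : ∀ t, ∫ x, x t ∂ν = m t) (hK : ∀ t s, cov[fun x => x t, fun x => x s; ν] = K t s)
    {A Q μ : ℝ} (hv : 0 ≤ K 0 0) (hS : 0 < 1 + (A ^ 2 - μ * Q) * K 0 0)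
    {H : ℝ → ℝ} (hH : Measurable H) :
    ∃ ν' : ℝ → Measure (Fin n → ℝ), (∀ y, IsGaussian (ν' y)) ∧
      (∀ y t, ∫ x, x t ∂ν' y = m t.succ + K t.succ 0 *
        ((A * (y - A * m 0) - μ * Q * (H y - m 0)) / (1 + (A ^ 2 - μ * Q) * K 0 0))) ∧
      (∀ y t s, cov[fun x => x t, fun x => x s; ν' y] =
        K t.succ s.succ - K t.succ 0 * K s.succ 0 *
          ((A ^ 2 - μ * Q) / (1 + (A ^ 2 - μ * Q) * K 0 0))) ∧
      ∀ G : ℝ → (Fin n → ℝ) → ℝ≥0∞, Measurable (Function.uncurry G) →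
        ∫⁻ x, ∫⁻ e, ENNReal.ofReal (Real.exp (μ / 2 * ((x 0 - H (A * x 0 + e)) ^ 2 * Q))) *
            G (A * x 0 + e) (fun t => x t.succ) ∂gaussianReal 0 1 ∂ν =
          ∫⁻ y, ENNReal.ofReal (√((1 + A ^ 2 * K 0 0) / (1 + (A ^ 2 - μ * Q) * K 0 0))) *
            (gaussianPDF (A * m 0) (1 + A ^ 2 * K 0 0).toNNReal y *
              (ENNReal.ofReal (Real.exp (μ *
                (Q * ((1 + A ^ 2 * K 0 0) / (2 * (1 + (A ^ 2 - μ * Q) * K 0 0))) *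
                (H y - m 0 - K 0 0 * A / (1 + A ^ 2 * K 0 0) * (y - A * m 0)) ^ 2))) *
                ∫⁻ x, G y x ∂ν' y)) := by
  choose ν' h1 h2 h3 h4 using fun y =>
    exists_isGaussian_tilt hm hK (A * (y - A * m 0) - μ * Q * (H y - m 0)) hS
  refine ⟨ν', h1, h2, h3, fun G hG => ?_⟩
  have hGy : ∀ y, Measurable (G y) := fun y => hG.comp measurable_prodMk_left
  have hG' : Measurable fun p : (Fin (n + 1) → ℝ) × ℝ => G p.2 fun t => p.1 t.succ :=
    hG.comp (measurable_snd.prodMk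
      (measurable_pi_lambda _ fun t => (measurable_pi_apply t.succ).comp measurable_fst))
  have hpdf : Measurable fun p : (Fin (n + 1) → ℝ) × ℝ => gaussianPDF (A * p.1 0) 1 p.2 :=
    measurable_uncurry_gaussianPDF.comp
      (f := fun p : (Fin (n + 1) → ℝ) × ℝ => (A * p.1 0, (1 : NNReal), p.2)) (by fun_prop)
  have e1 : ∀ x : Fin (n + 1) → ℝ,
      ∫⁻ e, ENNReal.ofReal (Real.exp (μ / 2 * ((x 0 - H (A * x 0 + e)) ^ 2 * Q))) *
        G (A * x 0 + e) (fun t => x t.succ) ∂gaussianReal 0 1 =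
      ∫⁻ y, gaussianPDF (A * x 0) 1 y *
        (ENNReal.ofReal (Real.exp (μ / 2 * ((x 0 - H y) ^ 2 * Q))) *
          G y (fun t => x t.succ)) := by
    intro x
    have hmeas : Measurable fun y => ENNReal.ofReal (Real.exp (μ / 2 * ((x 0 - H y) ^ 2 * Q))) *
        G y (fun t => x t.succ) :=
      Measurable.mul (by fun_prop) (hG.comp (measurable_id.prodMk measurable_const))
    have e2 := gaussianReal_map_const_add (μ := 0) (v := 1) (A * x 0)
    rw [zero_add] at e2
    rw [← lintegral_map (f := fun y =>
      ENNReal.ofReal (Real.exp (μ / 2 * ((x 0 - H y) ^ 2 * Q))) * G y (fun t => x t.succ))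
      (g := fun e => A * x 0 + e) hmeas (by fun_prop), e2,
      gaussianReal_of_var_ne_zero _ one_ne_zero,
      lintegral_withDensity_eq_lintegral_mul _ (measurable_gaussianPDF _ _) hmeas]
    rfl
  simp_rw [e1]
  rw [lintegral_lintegral_swap (by
    refine Measurable.aemeasurable ?_
    exact hpdf.mul (Measurable.mul (by fun_prop) hG'))]
  refine lintegral_congr fun y => ?_
  set c := (√(1 + (A ^ 2 - μ * Q) * K 0 0))⁻¹ *
    Real.exp ((A * (y - A * m 0) - μ * Q * (H y - m 0)) ^ 2 * K 0 0 /
      (2 * (1 + (A ^ 2 - μ * Q) * K 0 0))) with hc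
  have hcpos : 0 < c := mul_pos (inv_pos.2 (Real.sqrt_pos.2 hS)) (Real.exp_pos _)
  have hc0 : ENNReal.ofReal c ≠ 0 := by simpa using hcpos
  -- Both sides are multiplied by the tilt's mass `c`, positive and finite, to match the pointwise
  -- identity.
  rw [← ENNReal.mul_right_inj hc0 ENNReal.ofReal_ne_top, ← lintegral_const_mul _ (by
    exact (hpdf.comp measurable_prodMk_right).mul (Measurable.mul (by fun_prop)
      (hG'.comp measurable_prodMk_right)))]
  have e2 : ∀ x : Fin (n + 1) → ℝ, ENNReal.ofReal c * (gaussianPDF (A * x 0) 1 y *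
      (ENNReal.ofReal (Real.exp (μ / 2 * ((x 0 - H y) ^ 2 * Q))) * G y fun t => x t.succ)) =
      ENNReal.ofReal (√((1 + A ^ 2 * K 0 0) / (1 + (A ^ 2 - μ * Q) * K 0 0)) *
        (gaussianPDFReal (A * m 0) (1 + A ^ 2 * K 0 0).toNNReal y * Real.exp (μ *
          (Q * ((1 + A ^ 2 * K 0 0) / (2 * (1 + (A ^ 2 - μ * Q) * K 0 0))) *
          (H y - m 0 - K 0 0 * A / (1 + A ^ 2 * K 0 0) * (y - A * m 0)) ^ 2)))) *
      (ENNReal.ofReal (Real.exp (-(A ^ 2 - μ * Q) / 2 * (x 0 - m 0) ^ 2 +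
        (A * (y - A * m 0) - μ * Q * (H y - m 0)) * (x 0 - m 0))) *
          G y fun t => x t.succ) := by
    intro x
    rw [← mul_assoc (ENNReal.ofReal _) (ENNReal.ofReal _) (G _ _), ← ENNReal.ofReal_mul
      (mul_nonneg (Real.sqrt_nonneg _) (mul_nonneg (gaussianPDFReal_nonneg _ _ _)
        (Real.exp_pos _).le)), ← exp_mul_gaussianPDFReal_observation hv hS, ← hc,
      ENNReal.ofReal_mul (mul_nonneg (gaussianPDFReal_nonneg _ _ _) (Real.exp_pos _).le),
      ENNReal.ofReal_mul (gaussianPDFReal_nonneg _ _ _), gaussianPDF]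
    ring
  simp_rw [e2]
  have hmeas : Measurable fun x : Fin (n + 1) → ℝ => G y fun t => x t.succ :=
    hG'.comp (measurable_prodMk_right (y := y))
  rw [lintegral_const_mul _ (by exact Measurable.mul (by fun_prop) hmeas), h4 y (G y) (hGy y), ← hc,
    ENNReal.ofReal_mul (Real.sqrt_nonneg _), ENNReal.ofReal_mul (gaussianPDFReal_nonneg _ _ _),
    gaussianPDF]
  ring

/-! ### The finite-horizon cost and its bound by induction -/

theorem lintegral_pi_fin_succ {n : ℕ} (μ : Measure ℝ) [SigmaFinite μ]
    {f : (Fin (n + 1) → ℝ) → ℝ≥0∞} (hf : Measurable f) :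
    ∫⁻ e, f e ∂Measure.pi (fun _ => μ) =
      ∫⁻ e₀, ∫⁻ e, f (Fin.cons e₀ e) ∂Measure.pi (fun _ => μ) ∂μ := by
  have h := (measurePreserving_piFinSuccAbove (fun _ : Fin (n + 1) => μ) 0).symm
  rw [← h.lintegral_comp hf, lintegral_prod _ (by fun_prop)]
  refine lintegral_congr fun e₀ => lintegral_congr fun e => ?_
  simp [MeasurableEquiv.piFinSuccAbove, Fin.consEquiv]

theorem measurable_fin_cons {n : ℕ} {α : Type*} [MeasurableSpace α] {f : α → ℝ}
    {g : α → Fin n → ℝ} (hf : Measurable f) (hg : Measurable g) :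
    Measurable fun a => (Fin.cons (f a) (g a) : Fin (n + 1) → ℝ) := by
  refine measurable_pi_lambda _ fun t => ?_
  cases t using Fin.cases with
  | zero => simpa using hf
  | succ t =>
    simp only [Fin.cons_succ]
    exact (measurable_pi_apply t).comp hg

/-- The expected exponential cost of nonanticipative estimators `h`, for a signal of law `ν`
observed in standard Gaussian white noise. -/
noncomputable def expCost {n : ℕ} (μ : ℝ) (A Q : Fin n → ℝ) (ν : Measure (Fin n → ℝ))
    (h : Fin n → (Fin n → ℝ) → ℝ) : ℝ≥0∞ :=
  ∫⁻ x, ∫⁻ e, ENNReal.ofReal (Real.exp (μ / 2 *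
    ∑ t, (x t - h t (fun s => A s * x s + e s)) ^ 2 * Q t))
      ∂Measure.pi (fun _ => gaussianReal 0 1) ∂ν

/-- By nonanticipativity the first estimate sees only the first observation, so later ones may be
replaced by 0 and its cost leaves the inner integral. -/
theorem expCost_succ {n : ℕ} (μ : ℝ) (A Q : Fin (n + 1) → ℝ) (ν : Measure (Fin (n + 1) → ℝ))
    {h : Fin (n + 1) → (Fin (n + 1) → ℝ) → ℝ} (hh : ∀ t, Measurable (h t))
    (hna : ∀ t y y', (∀ s ≤ t, y s = y' s) → h t y = h t y') :
    expCost μ A Q ν h =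
      ∫⁻ x, ∫⁻ e, ENNReal.ofReal (Real.exp (μ / 2 *
          ((x 0 - h 0 (Fin.cons (A 0 * x 0 + e) 0)) ^ 2 * Q 0))) *
        (∫⁻ e', ENNReal.ofReal (Real.exp (μ / 2 *
          ∑ t : Fin n, (x t.succ - h t.succ (Fin.cons (A 0 * x 0 + e)
            (fun s => A s.succ * x s.succ + e' s))) ^ 2 * Q t.succ))
          ∂Measure.pi (fun _ => gaussianReal 0 1)) ∂gaussianReal 0 1 ∂ν := by
  refine lintegral_congr fun x => ?_
  rw [lintegral_pi_fin_succ _ (by fun_prop)]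
  refine lintegral_congr fun e => ?_
  have hc : Measurable fun e' : Fin n → ℝ =>
      (Fin.cons (A 0 * x 0 + e) (fun s => A s.succ * x s.succ + e' s) : Fin (n + 1) → ℝ) :=
    measurable_fin_cons measurable_const (by fun_prop)
  rw [← lintegral_const_mul _ (by fun_prop)]
  refine lintegral_congr fun e' => ?_
  have hy : (fun s : Fin (n + 1) => A s * x s + (Fin.cons e e' : Fin (n + 1) → ℝ) s) =
      Fin.cons (A 0 * x 0 + e) (fun s => A s.succ * x s.succ + e' s) := by
    funext s
    cases s using Fin.cases <;> simp
  rw [← ENNReal.ofReal_mul (Real.exp_pos _).le, ← Real.exp_add, ← mul_add, Fin.sum_univ_succ, hy,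
    hna 0 (Fin.cons (A 0 * x 0 + e) fun s => A s.succ * x s.succ + e' s)
      (Fin.cons (A 0 * x 0 + e) 0) (fun s hs => by simp [Fin.le_zero_iff.1 hs])]

/-- Lower (upper) bound for the exponential cost of every estimator, attained by the filter. -/
theorem expCost_bound (μ : ℝ) {n : ℕ} (A Q : Fin n → ℝ) (γ K : Fin n → Fin n → ℝ) (m : Fin n → ℝ)
    (ν : Measure (Fin n → ℝ)) [IsGaussian ν] (h : Fin n → (Fin n → ℝ) → ℝ)
    (hQ : ∀ t, 0 ≤ Q t)
    (hm : ∀ t, ∫ x, x t ∂ν = m t) (hK : ∀ t s, cov[fun x => x t, fun x => x s; ν] = K t s)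
    (hγ : ∀ s t, s ≤ t → γ t s = K t s - ∑ l, if l < s then
      γ t l * γ s l * ((A l ^ 2 - μ * Q l) / (1 + (A l ^ 2 - μ * Q l) * γ l l)) else 0)
    (hγ0 : ∀ t, 0 ≤ γ t t) (hS : ∀ t, 0 < 1 + (A t ^ 2 - μ * Q t) * γ t t)
    (hh : ∀ t, Measurable (h t)) (hna : ∀ t y y', (∀ s ≤ t, y s = y' s) → h t y = h t y') :
    (0 ≤ μ → ENNReal.ofReal
        (∏ t, √((1 + A t ^ 2 * γ t t) / (1 + (A t ^ 2 - μ * Q t) * γ t t))) ≤ expCost μ A Q ν h) ∧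
      (μ ≤ 0 → expCost μ A Q ν h ≤ ENNReal.ofReal
        (∏ t, √((1 + A t ^ 2 * γ t t) / (1 + (A t ^ 2 - μ * Q t) * γ t t)))) ∧
      ((∀ t y, h t y = m t + ∑ l, if l ≤ t then A l * γ t l * (y l - A l * h l y) else 0) →
        expCost μ A Q ν h = ENNReal.ofReal
        (∏ t, √((1 + A t ^ 2 * γ t t) / (1 + (A t ^ 2 - μ * Q t) * γ t t)))) := by
  induction n with
  | zero => simp [expCost]
  | succ n ih =>
    have hγK : ∀ t, γ t 0 = K t 0 := fun t => by simpa using hγ 0 t (Fin.zero_le t)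
    have hK0 : 0 ≤ K 0 0 := hγK 0 ▸ hγ0 0
    have hS0 : 0 < 1 + (A 0 ^ 2 - μ * Q 0) * K 0 0 := hγK 0 ▸ hS 0
    have hB0 : 0 < 1 + A 0 ^ 2 * K 0 0 := by positivity
    have hcons0 : Measurable fun y : ℝ => (Fin.cons y 0 : Fin (n + 1) → ℝ) :=
      measurable_fin_cons measurable_id measurable_const
    obtain ⟨ν', hν', hm', hK', hstep⟩ := exists_isGaussian_lintegral_observation hm hK hK0 hS0
      (H := fun y => h 0 (Fin.cons y 0)) ((hh 0).comp hcons0)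
    set h' : ℝ → Fin n → (Fin n → ℝ) → ℝ := fun y t y' => h t.succ (Fin.cons y y') with hh'
    set A' : Fin n → ℝ := fun t => A t.succ with hA'
    set Q' : Fin n → ℝ := fun t => Q t.succ with hQ'
    set c := ∏ t : Fin n, √((1 + A' t ^ 2 * γ t.succ t.succ) /
      (1 + (A' t ^ 2 - μ * Q' t) * γ t.succ t.succ)) with hc
    -- The shifted `γ` solves the Riccati–Volterra equation for the tilted covariance: the `l = 0`
    -- term of the sum is exactly the covariance correction. Only the mean depends on `y`.
    have ih' := fun y => ih A' Q' (fun t s => γ t.succ s.succ)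
      (fun t s => K t.succ s.succ - K t.succ 0 * K s.succ 0 *
        ((A 0 ^ 2 - μ * Q 0) / (1 + (A 0 ^ 2 - μ * Q 0) * K 0 0))) _ (ν' y) (h' y)
      (fun t => hQ _) (hm' y) (hK' y) (fun s t hst => by
        rw [hγ s.succ t.succ (Fin.succ_le_succ_iff.2 hst), Fin.sum_univ_succ]
        simp only [Fin.succ_pos, if_true, Fin.succ_lt_succ_iff, hγK]
        ring)
      (fun t => hγ0 _) (fun t => hS _)
      (fun t => (hh t.succ).comp (measurable_fin_cons measurable_const measurable_id))
      (fun t y₁ y₂ h12 => hna _ _ _ fun s hs => by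
        cases s using Fin.cases with
        | zero => rfl
        | succ s => simpa using h12 s (Fin.succ_le_succ_iff.1 hs))
    have hmeas : Measurable (Function.uncurry fun (y : ℝ) (x : Fin n → ℝ) =>
        ∫⁻ e, ENNReal.ofReal (Real.exp (μ / 2 *
          ∑ t, (x t - h' y t (fun s => A' s * x s + e s)) ^ 2 * Q' t))
          ∂Measure.pi (fun _ => gaussianReal 0 1)) := by
      have h1 : Measurable fun p : (ℝ × (Fin n → ℝ)) × (Fin n → ℝ) =>
          (Fin.cons p.1.1 (fun s => A' s * p.1.2 s + p.2 s) : Fin (n + 1) → ℝ) :=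
        measurable_fin_cons (by fun_prop) (by fun_prop)
      refine Measurable.lintegral_prod_right' (f := fun p : (ℝ × (Fin n → ℝ)) × (Fin n → ℝ) =>
        ENNReal.ofReal (Real.exp (μ / 2 *
          ∑ t, (p.1.2 t - h t.succ (Fin.cons p.1.1 (fun s => A' s * p.1.2 s + p.2 s))) ^ 2 *
            Q' t))) ?_
      fun_prop
    have hcost := (expCost_succ μ A Q ν hh hna).trans (hstep _ hmeas)
    change _ = ∫⁻ y, ENNReal.ofReal _ * (_ * (_ * expCost μ A' Q' (ν' y) (h' y))) at hcost
    set C := √((1 + A 0 ^ 2 * K 0 0) / (1 + (A 0 ^ 2 - μ * Q 0) * K 0 0)) with hC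
    -- The target is spread over `y` using a density of mass 1; `ENNReal.ofReal 1` stands where the
    -- cost has its extra factor, so integrands compare term by term.
    have hprod : ENNReal.ofReal (∏ t, √((1 + A t ^ 2 * γ t t) /
        (1 + (A t ^ 2 - μ * Q t) * γ t t))) = ∫⁻ y, ENNReal.ofReal C *
          (gaussianPDF (A 0 * m 0) (1 + A 0 ^ 2 * K 0 0).toNNReal y *
            (ENNReal.ofReal 1 * ENNReal.ofReal c)) := by
      rw [lintegral_const_mul _ (by fun_prop), lintegral_mul_const _ (by fun_prop),
        lintegral_gaussianPDF_eq_one _ (by simpa using hB0), Fin.prod_univ_succ,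
        ENNReal.ofReal_mul (Real.sqrt_nonneg _), hγK, ← hC]
      simp [hc, hA', hQ']
    have hcoef : 0 ≤ Q 0 * ((1 + A 0 ^ 2 * K 0 0) / (2 * (1 + (A 0 ^ 2 - μ * Q 0) * K 0 0))) :=
      mul_nonneg (hQ 0) (div_nonneg hB0.le (mul_pos two_pos hS0).le)
    rw [hcost, hprod]
    refine ⟨fun hμ => lintegral_mono fun y => ?_, fun hμ => lintegral_mono fun y => ?_,
      fun hsol => lintegral_congr fun y => ?_⟩
    · gcongr
      · exact Real.one_le_exp (mul_nonneg hμ (mul_nonneg hcoef (sq_nonneg _)))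
      · exact (ih' y).1 hμ
    · gcongr
      · exact Real.exp_le_one_iff.2 (mul_nonpos_of_nonpos_of_nonneg hμ
          (mul_nonneg hcoef (sq_nonneg _)))
      · exact (ih' y).2.1 hμ
    · have h0 : ∀ y', h 0 (Fin.cons y y') = h 0 (Fin.cons y 0) := fun y' =>
        hna 0 _ _ fun s hs => by simp [Fin.le_zero_iff.1 hs]
      have h1 : h 0 (Fin.cons y 0) = m 0 + A 0 * K 0 0 * (y - A 0 * h 0 (Fin.cons y 0)) := by
        have := hsol 0 (Fin.cons y 0)
        rw [Fin.sum_univ_succ] at this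
        simpa [hγK] using this
      have h2 : h 0 (Fin.cons y 0) - m 0 -
          K 0 0 * A 0 / (1 + A 0 ^ 2 * K 0 0) * (y - A 0 * m 0) = 0 := by
        field_simp
        linear_combination h1
      -- At the filter value the mean shift loses its `μ` dependence and becomes the innovation
      -- term, so the remaining equations form the filter of the reduced problem.
      have h3 : (A 0 * (y - A 0 * m 0) - μ * Q 0 * (h 0 (Fin.cons y 0) - m 0)) /
          (1 + (A 0 ^ 2 - μ * Q 0) * K 0 0) = A 0 * (y - A 0 * h 0 (Fin.cons y 0)) := by
        rw [div_eq_iff hS0.ne']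
        linear_combination (A 0 ^ 2 - μ * Q 0) * h1
      rw [(ih' y).2.2 fun t y' => ?_, h2]
      · simp [hc]
      · simp only [hh']
        rw [hsol t.succ, Fin.sum_univ_succ, h3]
        simp [hγK, h0, hA', Fin.succ_le_succ_iff]
        ring

/-! ### Reindexing the times up to `T` by `Fin T` -/

theorem image_succPNat_univ (T : ℕ+) :
    (Finset.univ : Finset (Fin T)).image (fun i => i.1.succPNat) = Finset.Iic T := by
  ext t
  simp only [Finset.mem_image, Finset.mem_univ, true_and, Finset.mem_Iic]
  constructor
  · rintro ⟨i, rfl⟩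
    exact PNat.coe_le_coe _ _ |>.1 i.2
  · intro ht
    refine ⟨⟨t.natPred, ?_⟩, PNat.succPNat_natPred t⟩
    have h1 := PNat.natPred_add_one t
    have h2 : (t : ℕ) ≤ T := ht
    lia

theorem succPNat_fin_injective (n : ℕ) : Function.Injective fun i : Fin n => i.1.succPNat :=
  fun _ _ h => Fin.ext (Nat.succPNat_injective h)

theorem succPNat_fin_le {T : ℕ+} (i : Fin T) : i.1.succPNat ≤ T :=
  (PNat.coe_le_coe _ _).1 i.2

theorem sum_eq_sum_fin_succPNat {T : ℕ+} {s : Finset ℕ+} (hs : s ⊆ Finset.Iic T) (f : ℕ+ → ℝ) :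
    ∑ t ∈ s, f t = ∑ i : Fin T, if i.1.succPNat ∈ s then f i.1.succPNat else 0 := by
  rw [← Finset.sum_image (f := fun t => if t ∈ s then f t else 0)
    (fun i _ j _ h => succPNat_fin_injective T h), image_succPNat_univ, Finset.sum_ite_mem,
    Finset.inter_eq_right.2 hs]

theorem prod_Iic_eq_prod_fin_succPNat (T : ℕ+) (f : ℕ+ → ℝ) :
    ∏ t ∈ Finset.Iic T, f t = ∏ i : Fin T, f i.1.succPNat := by
  rw [← image_succPNat_univ, Finset.prod_image fun i _ j _ h => succPNat_fin_injective T h]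

namespace LEG

/-! ### Observation σ-fields and the filter equation -/

theorem measurable_obsSigma {Ω : Type*} (Y : ℕ+ → Ω → ℝ) {s t : ℕ+} (h : s ≤ t) :
    Measurable[obsSigma Y t] (Y s) :=
  (comap_measurable (Y s)).mono (le_biSup (fun u => MeasurableSpace.comap (Y u) inferInstance)
    (Finset.mem_Iic.2 h)) le_rfl

/-- Doob–Dynkin factorisation through the observations up to `t`, read as a functional of whole
paths that ignores later times. -/
theorem exists_eq_of_measurable_obsSigma {Ω : Type*} {Y : ℕ+ → Ω → ℝ} {t : ℕ+} {f : Ω → ℝ}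
    (hf : Measurable[obsSigma Y t] f) :
    ∃ g : (ℕ+ → ℝ) → ℝ, Measurable g ∧ (∀ y y', (∀ s ≤ t, y s = y' s) → g y = g y') ∧
      ∀ ω, f ω = g fun s => Y s ω := by
  have hle : obsSigma Y t ≤ MeasurableSpace.comap
      (fun ω (u : Finset.Iic t) => Y u ω) MeasurableSpace.pi := by
    refine iSup₂_le fun u hu => ?_
    rintro _ ⟨B, hB, rfl⟩
    exact ⟨(fun z : Finset.Iic t → ℝ => z ⟨u, hu⟩) ⁻¹' B, measurable_pi_apply _ hB, rfl⟩
  obtain ⟨g, hg, hfg⟩ := (hf.mono hle le_rfl).exists_eq_measurable_comp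
  refine ⟨fun y => g fun u => y u, hg.comp (by fun_prop), fun y y' h => ?_,
    fun ω => congrFun hfg ω⟩
  exact congrArg g (funext fun u => h u (Finset.mem_Iic.1 u.2))

/-- The solution of the filtering equation driven by the path `y`. -/
noncomputable def filterPath (m A : ℕ+ → ℝ) (γ : ℕ+ → ℕ+ → ℝ) (y : ℕ+ → ℝ) (t : ℕ+) : ℝ :=
  (m t + ∑ l : Finset.Iio t, A l * γ t l * (y l - A l * filterPath m A γ y l) +
    A t * γ t t * y t) / (1 + A t ^ 2 * γ t t)
termination_by t
decreasing_by
  have hl : (l : ℕ+) < t := Finset.mem_Iio.1 l.2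
  exact hl

theorem filterPath_eq (m A : ℕ+ → ℝ) (γ : ℕ+ → ℕ+ → ℝ) (y : ℕ+ → ℝ) (t : ℕ+) :
    filterPath m A γ y t = (m t + ∑ l ∈ Finset.Iio t,
      A l * γ t l * (y l - A l * filterPath m A γ y l) + A t * γ t t * y t) /
        (1 + A t ^ 2 * γ t t) := by
  rw [filterPath, Finset.sum_coe_sort (Finset.Iio t)
    fun l => A l * γ t l * (y l - A l * filterPath m A γ y l)]

/-- The equation is implicit in `h t` only through the term `l = t`; moving that term to the left
gives an explicit recursion, hence existence and uniqueness. -/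
theorem filter_equation_iff {m A : ℕ+ → ℝ} {γ : ℕ+ → ℕ+ → ℝ} {t : ℕ+}
    (hB : 1 + A t ^ 2 * γ t t ≠ 0) (y h : ℕ+ → ℝ) :
    h t = m t + ∑ l ∈ Finset.Iic t, A l * γ t l * (y l - A l * h l) ↔
      h t = (m t + ∑ l ∈ Finset.Iio t, A l * γ t l * (y l - A l * h l) + A t * γ t t * y t) /
        (1 + A t ^ 2 * γ t t) := by
  rw [eq_div_iff hB, ← Finset.Iio_insert, Finset.sum_insert (by simp)]
  constructor <;> intro h <;> linear_combination h

theorem filterPath_solves {m A : ℕ+ → ℝ} {γ : ℕ+ → ℕ+ → ℝ} {t : ℕ+}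
    (hB : 1 + A t ^ 2 * γ t t ≠ 0) (y : ℕ+ → ℝ) :
    filterPath m A γ y t = m t + ∑ l ∈ Finset.Iic t,
      A l * γ t l * (y l - A l * filterPath m A γ y l) :=
  (filter_equation_iff hB y (filterPath m A γ y)).2 (filterPath_eq m A γ y t)

theorem SolvesFilter.eq_filterPath {Ω : Type*} {T : ℕ+} {m A : ℕ+ → ℝ} {γ : ℕ+ → ℕ+ → ℝ}
    {Y h : ℕ+ → Ω → ℝ} (hh : SolvesFilter T m A γ Y h)
    (hB : ∀ t ≤ T, 1 + A t ^ 2 * γ t t ≠ 0) (ω : Ω) :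
    ∀ t ≤ T, h t ω = filterPath m A γ (fun s => Y s ω) t := by
  intro t
  induction t using PNat.strongInductionOn with
  | _ t ih =>
    intro ht
    have h1 := (filter_equation_iff (hB t ht) (fun s => Y s ω) (fun s => h s ω)).1 (hh t ht ω)
    rw [h1, filterPath_eq, Finset.sum_congr rfl fun l hl => ?_]
    have hl' := Finset.mem_Iio.1 hl
    rw [ih l hl' (hl'.le.trans ht)]

theorem measurable_filterPath_comp {Ω : Type*} {_ : MeasurableSpace Ω} {Y : ℕ+ → Ω → ℝ}
    (m A : ℕ+ → ℝ) (γ : ℕ+ → ℕ+ → ℝ) (t : ℕ+) (hY : ∀ s ≤ t, Measurable (Y s)) :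
    Measurable fun ω => filterPath m A γ (fun s => Y s ω) t := by
  induction t using PNat.strongInductionOn with
  | _ t ih =>
    simp_rw [filterPath_eq m A γ _ t]
    refine Measurable.div_const (Measurable.add (Measurable.add measurable_const
      (Finset.measurable_sum _ fun l hl => ?_)) ((hY t le_rfl).const_mul _)) _
    have hl' := Finset.mem_Iio.1 hl
    exact ((hY l hl'.le).sub ((ih l hl' fun s hs => hY s (hs.trans hl'.le)).const_mul _)).const_mul _

theorem filterPath_congr (m A : ℕ+ → ℝ) (γ : ℕ+ → ℕ+ → ℝ) (t : ℕ+) {y y' : ℕ+ → ℝ}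
    (h : ∀ s ≤ t, y s = y' s) : filterPath m A γ y t = filterPath m A γ y' t := by
  induction t using PNat.strongInductionOn with
  | _ t ih =>
    rw [filterPath_eq, filterPath_eq m A γ y', h t le_rfl, Finset.sum_congr rfl fun l hl => ?_]
    have hl' := Finset.mem_Iio.1 hl
    rw [ih l hl' fun s hs => h s (hs.trans hl'.le), h l hl'.le]

/-- Extension of a finite path by zero. -/
def extendPath {n : ℕ} (y : Fin n → ℝ) (s : ℕ+) : ℝ :=
  if h : s.natPred < n then y ⟨s.natPred, h⟩ else 0

@[simp]
theorem extendPath_succPNat {n : ℕ} (y : Fin n → ℝ) (i : Fin n) :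
    extendPath y i.1.succPNat = y i := by
  simp [extendPath]

theorem measurable_extendPath {n : ℕ} :
    Measurable (extendPath : (Fin n → ℝ) → ℕ+ → ℝ) := by
  refine measurable_pi_lambda _ fun s => ?_
  unfold extendPath
  split_ifs <;> fun_prop

theorem extendPath_congr {n : ℕ} {y y' : Fin n → ℝ} {t : Fin n} (h : ∀ s ≤ t, y s = y' s) :
    ∀ s ≤ t.1.succPNat, extendPath y s = extendPath y' s := by
  intro s hs
  have h2 : s.natPred ≤ t.1 := by
    have h1 := PNat.natPred_add_one s
    have h3 : (s : ℕ) ≤ t.1 + 1 := hs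
    lia
  simp only [extendPath, h2.trans_lt t.2, dif_pos]
  exact h _ h2

theorem exists_pnat_fin {T : ℕ+} {s : ℕ+} (hs : s ≤ T) : ∃ i : Fin T, i.1.succPNat = s := by
  have h := Finset.mem_Iic.2 hs
  rw [← image_succPNat_univ] at h
  simpa using h

/-! ### From the probability space to finite-dimensional laws -/

theorem map_prodMk_signal_noise {Ω : Type*} [MeasurableSpace Ω] {P : Measure Ω}
    [IsProbabilityMeasure P] {X ε : ℕ+ → Ω → ℝ} (hX : ∀ t, Measurable (X t))
    (hε : ∀ t, Measurable (ε t)) (hε_law : ∀ t, P.map (ε t) = gaussianReal 0 1)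
    (hε_indep : iIndepFun ε P) (hXε : IndepFun (fun ω t => X t ω) (fun ω t => ε t ω) P) (n : ℕ) :
    P.map (fun ω => ((fun i : Fin n => X i.1.succPNat ω), fun i : Fin n => ε i.1.succPNat ω)) =
      (P.map fun ω (i : Fin n) => X i.1.succPNat ω).prod
        (Measure.pi fun _ => gaussianReal 0 1) := by
  have h1 : IndepFun (fun ω (i : Fin n) => X i.1.succPNat ω)
      (fun ω (i : Fin n) => ε i.1.succPNat ω) P :=
    hXε.comp (φ := fun (x : ℕ+ → ℝ) (i : Fin n) => x i.1.succPNat)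
      (ψ := fun (x : ℕ+ → ℝ) (i : Fin n) => x i.1.succPNat) (by fun_prop) (by fun_prop)
  have h2 := (iIndepFun_iff_map_fun_eq_pi_map
    (f := fun (i : Fin n) ω => ε i.1.succPNat ω) fun i => (hε _).aemeasurable).1
    (hε_indep.precomp (succPNat_fin_injective n))
  rw [(indepFun_iff_map_prod_eq_prod_map_map
    (measurable_pi_lambda _ fun i => hX _).aemeasurable
    (measurable_pi_lambda _ fun i => hε _).aemeasurable).1 h1, h2]
  simp_rw [hε_law]

theorem lintegral_exp_eq_expCost {Ω : Type*} [MeasurableSpace Ω] {P : Measure Ω}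
    [IsProbabilityMeasure P] {X ε : ℕ+ → Ω → ℝ} (hX : ∀ t, Measurable (X t))
    (hε : ∀ t, Measurable (ε t)) (hε_law : ∀ t, P.map (ε t) = gaussianReal 0 1)
    (hε_indep : iIndepFun ε P) (hXε : IndepFun (fun ω t => X t ω) (fun ω t => ε t ω) P)
    (T : ℕ+) (μ : ℝ) (A Q : ℕ+ → ℝ) {h : ℕ+ → Ω → ℝ} {g : Fin T → (Fin T → ℝ) → ℝ}
    (hg : ∀ t, Measurable (g t))
    (hgh : ∀ t ω, h t.1.succPNat ω = g t fun s => obs A X ε s.1.succPNat ω) :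
    ∫⁻ ω, ENNReal.ofReal (Real.exp
        (μ / 2 * ∑ t ∈ Finset.Iic T, (X t ω - h t ω) ^ 2 * Q t)) ∂P =
      expCost μ (fun i : Fin T => A i.1.succPNat) (fun i => Q i.1.succPNat)
        (P.map fun ω (i : Fin T) => X i.1.succPNat ω) g := by
  have : IsProbabilityMeasure (P.map fun ω (i : Fin T) => X i.1.succPNat ω) :=
    Measure.isProbabilityMeasure_map (measurable_pi_lambda _ fun i => hX _).aemeasurable
  rw [expCost, ← lintegral_prod (fun p : (Fin T → ℝ) × (Fin T → ℝ) =>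
    ENNReal.ofReal (Real.exp (μ / 2 * ∑ t : Fin T, (p.1 t -
      g t (fun s => A s.1.succPNat * p.1 s + p.2 s)) ^ 2 * Q t.1.succPNat))) (by fun_prop),
    ← map_prodMk_signal_noise hX hε hε_law hε_indep hXε, lintegral_map (by fun_prop) (by fun_prop)]
  refine lintegral_congr fun ω => ?_
  rw [sum_eq_sum_fin_succPNat subset_rfl]
  simp [succPNat_fin_le, hgh, obs]

theorem isGaussian_map_signal {Ω : Type*} [MeasurableSpace Ω] {P : Measure Ω}
    {X : ℕ+ → Ω → ℝ} (hX : IsGaussianProcess X P) (n : ℕ) :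
    IsGaussian (P.map fun ω (i : Fin n) => X i.1.succPNat ω) := by
  let I : Finset ℕ+ := Finset.univ.image fun i : Fin n => i.1.succPNat
  let L : (I → ℝ) →L[ℝ] (Fin n → ℝ) := ContinuousLinearMap.pi fun i =>
    ContinuousLinearMap.proj (R := ℝ) (φ := fun _ : I => ℝ)
      ⟨i.1.succPNat, Finset.mem_image_of_mem _ (Finset.mem_univ i)⟩
  exact ((hX.hasGaussianLaw I).map_fun L).isGaussian_map

/-- Multiplying by a negative `μ` reverses order, so maximality of the exponential expectation
becomes minimality of the risk. -/
theorem risk_mono {Ω : Type*} [MeasurableSpace Ω] {P : Measure Ω} {T : ℕ+} {μ : ℝ} {Q : ℕ+ → ℝ}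
    {X h h' : ℕ+ → Ω → ℝ} {c : ℝ≥0∞}
    (h1 : ∫⁻ ω, ENNReal.ofReal (Real.exp
      (μ / 2 * ∑ t ∈ Finset.Iic T, (X t ω - h t ω) ^ 2 * Q t)) ∂P = c)
    (h2 : 0 ≤ μ → c ≤ ∫⁻ ω, ENNReal.ofReal (Real.exp
      (μ / 2 * ∑ t ∈ Finset.Iic T, (X t ω - h' t ω) ^ 2 * Q t)) ∂P)
    (h3 : μ ≤ 0 → ∫⁻ ω, ENNReal.ofReal (Real.exp
      (μ / 2 * ∑ t ∈ Finset.Iic T, (X t ω - h' t ω) ^ 2 * Q t)) ∂P ≤ c) :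
    risk P T μ Q X h ≤ risk P T μ Q X h' := by
  simp only [risk, h1]
  rcases le_total 0 μ with hμ | hμ
  · exact mul_le_mul_of_nonneg_left (EReal.coe_ennreal_le_coe_ennreal_iff.2 (h2 hμ))
      (EReal.coe_nonneg.2 hμ)
  · have h4 : (0 : EReal) ≤ ((-μ : ℝ) : EReal) := EReal.coe_nonneg.2 (neg_nonneg.2 hμ)
    have h5 := mul_le_mul_of_nonneg_left (EReal.coe_ennreal_le_coe_ennreal_iff.2 (h3 hμ)) h4
    rw [EReal.coe_neg, EReal.neg_mul, EReal.neg_mul] at h5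
    exact EReal.neg_le_neg_iff.1 h5

end LEG

/-! ### The main theorem -/

theorem theorem1 {Ω : Type*} [MeasurableSpace Ω] (P : Measure Ω) [IsProbabilityMeasure P]
    (T : ℕ+) (μ : ℝ) (m : ℕ+ → ℝ) (K : ℕ+ → ℕ+ → ℝ) (A Q : ℕ+ → ℝ) (X ε : ℕ+ → Ω → ℝ)
    (hQ : ∀ t, 0 ≤ Q t)
    (hX_meas : ∀ t, Measurable (X t)) (hε_meas : ∀ t, Measurable (ε t))
    (hX : IsGaussianProcess X P)
    (hm : ∀ t, ∫ ω, X t ω ∂P = m t)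
    (hK : ∀ t s, ∫ ω, (X t ω - m t) * (X s ω - m s) ∂P = K t s)
    (hε_law : ∀ t, P.map (ε t) = gaussianReal 0 1)
    (hε_indep : iIndepFun ε P)
    (hXε : IndepFun (fun ω t => X t ω) (fun ω t => ε t ω) P)
    (hC : LEG.CondC T μ K A Q)
    (γ : ℕ+ → ℕ+ → ℝ) (hγ : LEG.IsRiccatiVolterraSolution T μ K A Q γ) :
    (∃ h : ℕ+ → Ω → ℝ, LEG.SolvesFilter T m A γ (LEG.obs A X ε) h) ∧
    (∀ h h' : ℕ+ → Ω → ℝ, LEG.SolvesFilter T m A γ (LEG.obs A X ε) h →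
      LEG.SolvesFilter T m A γ (LEG.obs A X ε) h' → ∀ t ≤ T, h t = h' t) ∧
    ∀ hbar : ℕ+ → Ω → ℝ, LEG.SolvesFilter T m A γ (LEG.obs A X ε) hbar →
      hbar ∈ LEG.adaptedEstimators T (LEG.obs A X ε) ∧
      IsMinOn (LEG.risk P T μ Q X) (LEG.adaptedEstimators T (LEG.obs A X ε)) hbar ∧
      LEG.risk P T μ Q X hbar =
        ((μ * ∏ t ∈ Finset.Iic T,
          ((1 + LEG.S μ A Q t * γ t t) / (1 + A t ^ 2 * γ t t)) ^ (-(1 / 2) : ℝ) : ℝ) : EReal) := by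
  obtain ⟨γ₀, -, huniq, -, hγ₀, hS₀⟩ := hC
  -- Uniqueness in `(C_μ)` carries the sign conditions over to the given solution `γ`.
  have heq := huniq γ hγ
  have hγ0 : ∀ t ≤ T, 0 ≤ γ t t := fun t ht => by rw [heq t t le_rfl ht]; exact hγ₀ t ht
  have hS : ∀ t ≤ T, 0 < 1 + LEG.S μ A Q t * γ t t := fun t ht => by
    rw [heq t t le_rfl ht]; exact hS₀ t ht
  have hB : ∀ t ≤ T, 0 < 1 + A t ^ 2 * γ t t := fun t ht => by
    have := hγ0 t ht
    positivity
  have hB' := fun t ht => (hB t ht).ne'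
  refine ⟨⟨fun t ω => LEG.filterPath m A γ (fun s => LEG.obs A X ε s ω) t,
    fun t ht ω => LEG.filterPath_solves (hB' t ht) _⟩, fun h h' hh hh' t ht => ?_,
    fun hbar hhbar => ?_⟩
  · funext ω
    rw [hh.eq_filterPath hB' ω t ht, hh'.eq_filterPath hB' ω t ht]
  -- the finite-horizon problem
  set ν := P.map fun ω (i : Fin T) => X i.1.succPNat ω with hν
  have hνG : IsGaussian ν := LEG.isGaussian_map_signal hX T
  have hXm : Measurable fun ω (i : Fin T) => X i.1.succPNat ω :=
    measurable_pi_lambda _ fun i => hX_meas _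
  set c : ℝ := ∏ t : Fin T, √((1 + A t.1.succPNat ^ 2 * γ t.1.succPNat t.1.succPNat) /
    (1 + (A t.1.succPNat ^ 2 - μ * Q t.1.succPNat) * γ t.1.succPNat t.1.succPNat)) with hc
  have hle : ∀ i j : Fin T, i.1.succPNat ≤ j.1.succPNat ↔ i ≤ j := fun i j =>
    Nat.succPNat_le_succPNat
  have hlt : ∀ i j : Fin T, i.1.succPNat < j.1.succPNat ↔ i < j := fun i j =>
    Nat.succPNat_lt_succPNat
  have bound := fun (g : Fin T → (Fin T → ℝ) → ℝ) (hg : ∀ t, Measurable (g t))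
      (hna : ∀ t y y', (∀ s ≤ t, y s = y' s) → g t y = g t y') =>
    expCost_bound μ (fun i : Fin T => A i.1.succPNat) (fun i => Q i.1.succPNat)
      (fun i j => γ i.1.succPNat j.1.succPNat) (fun i j => K i.1.succPNat j.1.succPNat)
      (fun i => m i.1.succPNat) ν g (fun t => hQ _)
      (fun t => by
        rw [hν, integral_map hXm.aemeasurable (measurable_pi_apply t).aestronglyMeasurable, hm])
      (fun t s => by
        rw [hν, covariance_map_fun (measurable_pi_apply t).aestronglyMeasurable
          (measurable_pi_apply s).aestronglyMeasurable hXm.aemeasurable]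
        simp only [covariance, hm, hK])
      (fun s t hst => by
        rw [(hγ _ _ ((hle s t).2 hst) (succPNat_fin_le t)).2,
          sum_eq_sum_fin_succPNat fun l hl => Finset.mem_Iic.2
            ((Finset.mem_Iio.1 hl).le.trans (succPNat_fin_le s))]
        simp only [Finset.mem_Iio, hlt, LEG.S])
      (fun t => hγ0 _ (succPNat_fin_le t)) (fun t => hS _ (succPNat_fin_le t)) hg hna
  have hopt : ∫⁻ ω, ENNReal.ofReal (Real.exp
      (μ / 2 * ∑ t ∈ Finset.Iic T, (X t ω - hbar t ω) ^ 2 * Q t)) ∂P = ENNReal.ofReal c := by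
    -- The filter as a functional of `T` observations; the zero extension is harmless because only
    -- times up to `t` are read.
    have hg : ∀ t : Fin T, Measurable fun y : Fin T → ℝ =>
        LEG.filterPath m A γ (LEG.extendPath y) t.1.succPNat := fun t =>
      LEG.measurable_filterPath_comp (Y := fun s y => LEG.extendPath y s) m A γ _ fun s _ =>
        (measurable_pi_apply s).comp LEG.measurable_extendPath
    rw [LEG.lintegral_exp_eq_expCost hX_meas hε_meas hε_law hε_indep hXε T μ A Q hg fun t ω => ?_]
    · refine (bound _ hg fun t y y' h => LEG.filterPath_congr m A γ _
        (LEG.extendPath_congr h)).2.2 fun t y => ?_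
      rw [LEG.filterPath_solves (hB' _ (succPNat_fin_le t)), sum_eq_sum_fin_succPNat
        (Finset.Iic_subset_Iic.2 (succPNat_fin_le t))]
      simp only [Finset.mem_Iic, hle, LEG.extendPath_succPNat]
    · rw [hhbar.eq_filterPath hB' ω _ (succPNat_fin_le t)]
      refine LEG.filterPath_congr m A γ _ fun s hs => ?_
      obtain ⟨i, rfl⟩ := LEG.exists_pnat_fin (hs.trans (succPNat_fin_le t))
      rw [LEG.extendPath_succPNat]
  refine ⟨fun t ht => ?_, fun h hh => ?_, ?_⟩
  · rw [show hbar t = _ from funext fun ω => hhbar.eq_filterPath hB' ω t ht]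
    exact LEG.measurable_filterPath_comp m A γ t fun s hs => LEG.measurable_obsSigma _ hs
  -- Any competitor is a nonanticipative functional of the observations, so the finite-horizon bound
  -- applies to it.
  · choose g hgm hgna hg using fun t : Fin T =>
      LEG.exists_eq_of_measurable_obsSigma (hh _ (succPNat_fin_le t))
    have hg' : ∀ t : Fin T, Measurable fun y : Fin T → ℝ => g t (LEG.extendPath y) := fun t =>
      (hgm t).comp LEG.measurable_extendPath
    have hbd := bound _ hg' fun t y y' h => hgna t _ _ (LEG.extendPath_congr h)
    rw [← LEG.lintegral_exp_eq_expCost hX_meas hε_meas hε_law hε_indep hXε T μ A Q hg'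
      (h := h) fun t ω => ?_] at hbd
    · exact LEG.risk_mono hopt hbd.1 hbd.2.1
    · rw [hg]
      refine hgna t _ _ fun s hs => ?_
      obtain ⟨i, rfl⟩ := LEG.exists_pnat_fin (hs.trans (succPNat_fin_le t))
      rw [LEG.extendPath_succPNat]
  · have hc0 : 0 ≤ c := Finset.prod_nonneg fun _ _ => Real.sqrt_nonneg _
    have hprod : ∏ t ∈ Finset.Iic T,
        ((1 + LEG.S μ A Q t * γ t t) / (1 + A t ^ 2 * γ t t)) ^ (-(1 / 2) : ℝ) = c := by
      rw [prod_Iic_eq_prod_fin_succPNat, hc]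
      refine Finset.prod_congr rfl fun t _ => ?_
      have h1 := hS _ (succPNat_fin_le t)
      have h2 := hB _ (succPNat_fin_le t)
      rw [Real.rpow_neg (div_pos h1 h2).le, ← Real.sqrt_eq_rpow, ← Real.sqrt_inv, inv_div, LEG.S]
    rw [LEG.risk, hopt, hprod, EReal.coe_ennreal_ofReal, max_eq_left hc0, EReal.coe_mul]
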